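/- Let $\omega = 2\int_0^1 (1+\tau^4)^{-1/2}\,d\tau$. There is a lattice in $\mathbb{C}$ with invariants $g_2=1$, $g_3=0$, and any such lattice equals $2\omega\mathbb{Z}+2i\omega\mathbb{Z}$; let $\wp$ be its Weierstrass function (the lemniscatic $\wp$). Let $U\subseteq\mathbb{C}$ be a connected open set containing $0$ and let $s,c$ be holomorphic functions on $U$ that satisfy $$s' = c^3,\qquad c' = -s^3,\qquad s(0)=0,\qquad c(0)=1 .$$ Then each of the functions $sc$, $c^2$ and $s^2$ extends from $U$ to an elliptic function on $\mathbb{C}$ having $2\omega$ and $2i\omega$ among its periods. Each of these three elliptic functions has poles exactly at the points congruent to $\tfrac12(\pm1\pm i)\omega$ (independent signs) modulo $2\omega$ and $2i\omega$, and all these poles are simple. Moreover $$sc = -\frac12\,\frac{\wp'}{\wp^2+1/4}$$ as an identity of meromorphic functions: off the lattice, it holds for the elliptic extension of $sc$ wherever $\wp^2+1/4\neq0$, and it holds for $sc$ itself at every point of $U$ off the lattice, $\wp^2+1/4$ being nonzero there. -/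

import Mathlib

namespace Lemniscatic

/-- The real half-period `ω = 2 ∫₀¹ dτ / (1 + τ⁴)^(1/2) = 1.85407…`. -/
noncomputable def omega : ℝ := 2 * ∫ τ in (0 : ℝ)..1, 1 / Real.sqrt (1 + τ ^ 4)

/-- The holomorphic functions `s`, `c` solve the initial value problem
`s' = c³`, `c' = -s³`, `s(0) = 0`, `c(0) = 1` on `U`. -/
structure IsIVPSolution (U : Set ℂ) (s c : ℂ → ℂ) : Prop where
  hasDerivAt_s : ∀ z ∈ U, HasDerivAt s (c z ^ 3) z
  hasDerivAt_c : ∀ z ∈ U, HasDerivAt c (-(s z) ^ 3) z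
  s_zero : s 0 = 0
  c_zero : c 0 = 1

/-- `f` is an elliptic function having `ω₁`, `ω₂` among its periods (they need not generate the
group of all periods): `ω₁`, `ω₂` are linearly independent over `ℝ`, and `f` is meromorphic in the
whole plane and invariant under translation by either of them. A meromorphic function is
represented by the function that is holomorphic away from its poles (all removable singularities
are removed) and has the conventional value `0` at its poles; this is Mathlib's normal form. -/
structure IsElliptic (ω₁ ω₂ : ℂ) (f : ℂ → ℂ) : Prop where
  indep : LinearIndependent ℝ ![ω₁, ω₂]
  meromorphic : MeromorphicNFOn f Set.univ
  periodic₁ : Function.Periodic f ω₁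
  periodic₂ : Function.Periodic f ω₂

/-- The set of poles of `f` is exactly `S`, and each of these poles is simple. -/
def HasSimplePolesExactlyAt (f : ℂ → ℂ) (S : Set ℂ) : Prop :=
  (∀ p, meromorphicOrderAt f p < 0 ↔ p ∈ S) ∧ ∀ p ∈ S, meromorphicOrderAt f p = -1

/-- The points congruent to one of `½ (±1 ± i) ω` (independent signs) modulo `2ω` and `2iω`. -/
def polePoints : Set ℂ :=
  {p | ∃ a ∈ ({1, -1} : Set ℂ), ∃ b ∈ ({1, -1} : Set ℂ), ∃ m n : ℤ,
    p = 1 / 2 * (a + b * Complex.I) * omega + m * (2 * omega) + n * (2 * Complex.I * omega)}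

/-- The period lattice `L` has invariants `g₂ = 1` and `g₃ = 0`, so that its Weierstrass function
is the lemniscatic `℘`. -/
def IsLemniscatic (L : PeriodPair) : Prop := L.g₂ = 1 ∧ L.g₃ = 0

end Lemniscatic

/-!
Two ideas drive the argument. First, the differential equation determines everything: `Q = 1 / ℘`
is analytic at `0` with `Q'' = 2 - (3/2) g₂ Q² - 2 g₃ Q³` and `Q(0) = Q'(0) = 0`, so `(g₂, g₃)`
determines `℘` and hence the lattice. The lattice spanned by `2a` and `2ia` has `g₃ = 0`, because it
is stable under multiplication by `i`, and `g₂ = 1` for a suitable real `a > 0`. Here `a = ω`: on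
`(0, a)` the function `y = -℘' / (2 (℘² - 1/4))` solves `y' = √(1 + y⁴)` and increases from `0` to
`∞`, and `y` and `1/y` reach the value `1` simultaneously, so that
`a = 2 ∫₀¹ dτ / √(1 + τ⁴)`.

Secondly, `(sc, s², c²)` solves a polynomial differential system, which the triple
`(-½ ℘', ℘, ℘² - ¼) / (℘² + ¼)` also solves near `0` with the same initial value. The poles are the
zeros of `℘² + ¼`: translation by the centre `ρ = (1 + i) ω` of the period square turns `℘` into
`-1 / (4℘)`, so that `℘² = -¼` means `℘(z + ρ) = ℘(z)`, that is, `2z + ρ` is a period.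
-/

namespace Lemniscatic

open Filter Topology ComplexConjugate

section Uniqueness

variable {E : Type*} [NormedAddCommGroup E] [NormedSpace ℂ E]

theorem eventuallyEq_of_hasDerivAt {v : E → E} {f g : ℂ → E} {a : ℂ}
    (hv : ContDiffAt ℂ 1 v (f a)) (hf : ∀ᶠ z in 𝓝 a, HasDerivAt f (v (f z)) z)
    (hg : ∀ᶠ z in 𝓝 a, HasDerivAt g (v (g z)) z) (h : f a = g a) : f =ᶠ[𝓝 a] g := by
  obtain ⟨K, s, hs, hK⟩ := hv.exists_lipschitzOnWith
  have hfs : ∀ᶠ z in 𝓝 a, f z ∈ s := hf.self_of_nhds.continuousAt hs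
  have hgs : ∀ᶠ z in 𝓝 a, g z ∈ s := hg.self_of_nhds.continuousAt (h ▸ hs)
  obtain ⟨r, hr, H⟩ := Metric.eventually_nhds_iff_ball.1 ((hf.and hg).and (hfs.and hgs))
  filter_upwards [Metric.ball_mem_nhds a hr] with z hz
  have hseg : ∀ t ∈ Set.Icc (0 : ℝ) 1, AffineMap.lineMap a z t ∈ Metric.ball a r := fun t ht =>
    (convex_ball a r).lineMap_mem (Metric.mem_ball_self hr) hz ht
  have hline (t : ℝ) : HasDerivAt (AffineMap.lineMap a z : ℝ → ℂ) (z - a) t :=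
    AffineMap.hasDerivAt_lineMap
  have hlip : LipschitzOnWith (‖z - a‖₊ * K) (fun y => (z - a) • v y) s :=
    (lipschitzWith_smul (z - a)).comp_lipschitzOnWith hK
  have hF {F : ℂ → E} (hF : ∀ x ∈ Metric.ball a r, HasDerivAt F (v (F x)) x) (t : ℝ)
      (ht : t ∈ Set.Icc (0 : ℝ) 1) : HasDerivAt (fun t : ℝ => F (AffineMap.lineMap a z t))
        ((z - a) • v (F (AffineMap.lineMap a z t))) t :=
    (hF _ (hseg t ht)).scomp t (hline t)
  have hf' := hF fun x hx => (H x hx).1.1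
  have hg' := hF fun x hx => (H x hx).1.2
  simpa using ODE_solution_unique_of_mem_Icc_right (fun _ _ => hlip)
    (fun t ht => (hf' t ht).continuousAt.continuousWithinAt)
    (fun t ht => (hf' t (Set.Ico_subset_Icc_self ht)).hasDerivWithinAt)
    (fun t ht => (H _ (hseg t (Set.Ico_subset_Icc_self ht))).2.1)
    (fun t ht => (hg' t ht).continuousAt.continuousWithinAt)
    (fun t ht => (hg' t (Set.Ico_subset_Icc_self ht)).hasDerivWithinAt)
    (fun t ht => (H _ (hseg t (Set.Ico_subset_Icc_self ht))).2.2)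
    (by simpa using h) (Set.right_mem_Icc.2 zero_le_one)

theorem eventuallyEq_of_hasDerivAt_hasDerivAt {φ : E → E} {f f' g g' : ℂ → E} {a : ℂ}
    (hφ : ContDiffAt ℂ 1 φ (f a))
    (hf : ∀ᶠ z in 𝓝 a, HasDerivAt f (f' z) z) (hf' : ∀ᶠ z in 𝓝 a, HasDerivAt f' (φ (f z)) z)
    (hg : ∀ᶠ z in 𝓝 a, HasDerivAt g (g' z) z) (hg' : ∀ᶠ z in 𝓝 a, HasDerivAt g' (φ (g z)) z)
    (h : f a = g a) (h' : f' a = g' a) : f =ᶠ[𝓝 a] g := by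
  have hv : ContDiffAt ℂ 1 (fun y : E × E => (y.2, φ y.1)) (f a, f' a) :=
    contDiffAt_snd.prodMk (hφ.comp (f a, f' a) contDiffAt_fst)
  have key := eventuallyEq_of_hasDerivAt (f := fun z => (f z, f' z)) (g := fun z => (g z, g' z))
    hv ((hf.and hf').mono fun _ h => h.1.prodMk h.2) ((hg.and hg').mono fun _ h => h.1.prodMk h.2)
    (Prod.ext h h')
  exact key.fun_comp Prod.fst

end Uniqueness

section NormalForm

variable {𝕜 E : Type*} [NontriviallyNormedField 𝕜] [NormedAddCommGroup E] [NormedSpace 𝕜 E]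
  {f g : 𝕜 → E} {U : Set 𝕜} {a : 𝕜}

theorem eqOn_of_meromorphicNFOn_of_eventuallyEq_nhdsNE (hf : MeromorphicNFOn f U)
    (hg : MeromorphicNFOn g U) (hU : IsPreconnected U) (ha : a ∈ U) (h : f =ᶠ[𝓝[≠] a] g) :
    Set.EqOn f g U := by
  intro z hz
  have htop : meromorphicOrderAt (f - g) a = ⊤ :=
    meromorphicOrderAt_eq_top_iff.2 (h.mono fun x hx => sub_eq_zero.2 hx)
  have hz_top : meromorphicOrderAt (f - g) z = ⊤ := by
    by_contra hne
    exact (hf.meromorphicOn.sub hg.meromorphicOn).meromorphicOrderAt_ne_top_of_isPreconnected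
      hU hz ha hne htop
  have hfg : f =ᶠ[𝓝[≠] z] g :=
    (meromorphicOrderAt_eq_top_iff.1 hz_top).mono fun x hx => sub_eq_zero.1 hx
  exact (((hf hz).eventuallyEq_nhdsNE_iff_eventuallyEq_nhds (hg hz)).1 hfg).self_of_nhds

theorem eq_of_meromorphicNFOn_univ_of_eventuallyEq_nhdsNE [PreconnectedSpace 𝕜]
    (hf : MeromorphicNFOn f Set.univ) (hg : MeromorphicNFOn g Set.univ) (h : f =ᶠ[𝓝[≠] a] g) :
    f = g :=
  (Set.eqOn_univ f g).1 <| eqOn_of_meromorphicNFOn_of_eventuallyEq_nhdsNE hf hg isPreconnected_univ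
    (Set.mem_univ a) h

end NormalForm

section Weierstrass

variable (L : PeriodPair)

theorem eventually_notMem_lattice (z : ℂ) : ∀ᶠ x in 𝓝[≠] z, x ∉ L.lattice := by
  filter_upwards [nhdsWithin_le_nhds (L.compl_lattice_sdiff_singleton_mem_nhds z),
    self_mem_nhdsWithin] with x hx hxz hxL
  exact hx ⟨hxL, hxz⟩

variable {L} in
theorem eventually_notMem_lattice_of_notMem {z : ℂ} (hz : z ∉ L.lattice) :
    ∀ᶠ x in 𝓝 z, x ∉ L.lattice :=
  L.isClosed_lattice.isOpen_compl.mem_nhds hz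

theorem meromorphicOrderAt_weierstrassP_neg_iff {z : ℂ} :
    meromorphicOrderAt L.weierstrassP z < 0 ↔ z ∈ L.lattice := by
  refine ⟨fun h => ?_, fun h => by rw [L.order_weierstrassP z h]; decide⟩
  by_contra hz
  exact (L.analyticOnNhd_weierstrassP z hz).meromorphicOrderAt_nonneg.not_gt h

theorem meromorphicNFOn_weierstrassP : MeromorphicNFOn L.weierstrassP Set.univ := by
  intro z _
  by_cases hz : z ∈ L.lattice
  · refine meromorphicNFAt_iff_analyticAt_or.2 (.inr ⟨L.meromorphic_weierstrassP z,
      (meromorphicOrderAt_weierstrassP_neg_iff L).2 hz, L.weierstrassP_coe ⟨z, hz⟩⟩)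
  · exact (L.analyticOnNhd_weierstrassP z hz).meromorphicNFAt

theorem meromorphicNFOn_weierstrassP_add_const (a : ℂ) :
    MeromorphicNFOn (fun z => L.weierstrassP (z + a)) Set.univ := fun z _ =>
  meromorphicNFAt_comp_add_const_iff_meromorphicNFAt.2
    (meromorphicNFOn_weierstrassP L (Set.mem_univ (z + a)))

theorem lattice_eq_of_weierstrassP_eq {L' : PeriodPair} (h : L.weierstrassP = L'.weierstrassP) :
    L.lattice = L'.lattice := by
  ext z
  rw [← meromorphicOrderAt_weierstrassP_neg_iff, h, meromorphicOrderAt_weierstrassP_neg_iff]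

variable {L} {a b z : ℂ}

theorem hasDerivAt_weierstrassP (hz : z ∉ L.lattice) :
    HasDerivAt L.weierstrassP (L.derivWeierstrassP z) z := by
  rw [← L.deriv_weierstrassP]
  exact (L.analyticOnNhd_weierstrassP z hz).differentiableAt.hasDerivAt

variable (L) in
theorem eventually_derivWeierstrassP_ne_zero (z : ℂ) :
    ∀ᶠ x in 𝓝[≠] z, L.derivWeierstrassP x ≠ 0 := by
  have h0 : meromorphicOrderAt L.derivWeierstrassP 0 ≠ ⊤ := by
    rw [← L.deriv_weierstrassP, meromorphicOrderAt_deriv_eq_sub_one (n := -2) (by norm_num)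
      (L.order_weierstrassP 0 (zero_mem _))]
    exact WithTop.coe_ne_top
  rw [← meromorphicOrderAt_ne_top_iff_eventually_ne_zero (L.meromorphic_derivWeierstrassP z)]
  have hmero : MeromorphicOn L.derivWeierstrassP Set.univ :=
    fun x _ => L.meromorphic_derivWeierstrassP x
  exact hmero.meromorphicOrderAt_ne_top_of_isPreconnected isPreconnected_univ
    (Set.mem_univ 0) (Set.mem_univ z) h0

/- Differentiating `℘'² = 4℘³ - g₂℘ - g₃` gives the claim wherever `℘' ≠ 0`. -/
theorem hasDerivAt_derivWeierstrassP (hz : z ∉ L.lattice) :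
    HasDerivAt L.derivWeierstrassP (6 * L.weierstrassP z ^ 2 - L.g₂ / 2) z := by
  have hana := L.analyticOnNhd_derivWeierstrassP z hz
  suffices h : deriv L.derivWeierstrassP =ᶠ[𝓝[≠] z]
      fun x => 6 * L.weierstrassP x ^ 2 - L.g₂ / 2 by
    have hcont : ContinuousAt (fun x => 6 * L.weierstrassP x ^ 2 - L.g₂ / 2) z :=
      (((hasDerivAt_weierstrassP hz).continuousAt.pow 2).const_mul 6).sub_const _
    exact hana.differentiableAt.hasDerivAt.congr_deriv
      ((hana.deriv.continuousAt.eventuallyEq_nhds_iff_eventuallyEq_nhdsNE hcont).1 h).self_of_nhds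
  filter_upwards [eventually_derivWeierstrassP_ne_zero L z, eventually_notMem_lattice L z]
    with x hx0 hx
  have hsq : (fun y => L.derivWeierstrassP y ^ 2) =ᶠ[𝓝 x]
      fun y => 4 * L.weierstrassP y ^ 3 - L.g₂ * L.weierstrassP y - L.g₃ :=
    (eventually_notMem_lattice_of_notMem hx).mono fun y hy => L.derivWeierstrassP_sq y hy
  have hP := hasDerivAt_weierstrassP hx
  have hlhs := (L.analyticOnNhd_derivWeierstrassP x hx).differentiableAt.hasDerivAt.pow 2
  have hrhs := (((hP.pow 3).const_mul 4).sub (hP.const_mul L.g₂)).sub_const L.g₃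
  have hderiv := (hlhs.congr_of_eventuallyEq hsq.symm).unique hrhs
  refine mul_left_cancel₀ (mul_ne_zero two_ne_zero hx0) ?_
  push_cast at hderiv
  linear_combination hderiv

theorem eventually_hasDerivAt_weierstrassP_add (ha : a ∉ L.lattice) :
    ∀ᶠ z in 𝓝 0, HasDerivAt (fun z => L.weierstrassP (z + a)) (L.derivWeierstrassP (z + a)) z ∧
      HasDerivAt (fun z => L.derivWeierstrassP (z + a))
        (6 * L.weierstrassP (z + a) ^ 2 - L.g₂ / 2) z := by
  have htendsto : Tendsto (fun z => z + a) (𝓝 0) (𝓝 a) := by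
    simpa using (continuous_add_const a).tendsto 0
  filter_upwards [htendsto (eventually_notMem_lattice_of_notMem ha)] with z hz
  exact ⟨(hasDerivAt_weierstrassP hz).comp_add_const z a,
    (hasDerivAt_derivWeierstrassP hz).comp_add_const z a⟩

theorem sub_mem_lattice_of_weierstrassP_eq_of_derivWeierstrassP_eq (ha : a ∉ L.lattice)
    (hb : b ∉ L.lattice) (h : L.weierstrassP a = L.weierstrassP b)
    (h' : L.derivWeierstrassP a = L.derivWeierstrassP b) : a - b ∈ L.lattice := by
  have hloc : (fun z => L.weierstrassP (z + a)) =ᶠ[𝓝 0] fun z => L.weierstrassP (z + b) := by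
    have hA := eventually_hasDerivAt_weierstrassP_add ha
    have hB := eventually_hasDerivAt_weierstrassP_add hb
    exact eventuallyEq_of_hasDerivAt_hasDerivAt (φ := fun y => 6 * y ^ 2 - L.g₂ / 2)
      (by fun_prop) (hA.mono fun _ h => h.1) (hA.mono fun _ h => h.2) (hB.mono fun _ h => h.1)
      (hB.mono fun _ h => h.2) (by simpa using h) (by simpa using h')
  have heq := eq_of_meromorphicNFOn_univ_of_eventuallyEq_nhdsNE
    (meromorphicNFOn_weierstrassP_add_const L a) (meromorphicNFOn_weierstrassP_add_const L b)
    (hloc.filter_mono nhdsWithin_le_nhds)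
  have hpole : meromorphicOrderAt L.weierstrassP (-b + a) < 0 := by
    rw [← meromorphicOrderAt_comp_add_const_eq_meromorphicOrderAt, Function.comp_def, heq,
      ← Function.comp_def, meromorphicOrderAt_comp_add_const_eq_meromorphicOrderAt,
      meromorphicOrderAt_weierstrassP_neg_iff, neg_add_cancel]
    exact zero_mem _
  rwa [meromorphicOrderAt_weierstrassP_neg_iff, neg_add_eq_sub] at hpole

theorem weierstrassP_eq_of_sub_mem_lattice (h : a - b ∈ L.lattice) :
    L.weierstrassP a = L.weierstrassP b := by
  simpa using L.weierstrassP_add_coe b ⟨a - b, h⟩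

theorem derivWeierstrassP_eq_of_sub_mem_lattice (h : a - b ∈ L.lattice) :
    L.derivWeierstrassP a = L.derivWeierstrassP b := by
  simpa using L.derivWeierstrassP_add_coe b ⟨a - b, h⟩

theorem weierstrassP_eq_weierstrassP_iff (ha : a ∉ L.lattice) (hb : b ∉ L.lattice) :
    L.weierstrassP a = L.weierstrassP b ↔ a - b ∈ L.lattice ∨ a + b ∈ L.lattice := by
  constructor
  · intro h
    have hsq : L.derivWeierstrassP a ^ 2 = L.derivWeierstrassP b ^ 2 := by
      rw [L.derivWeierstrassP_sq a ha, L.derivWeierstrassP_sq b hb, h]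
    refine (sq_eq_sq_iff_eq_or_eq_neg.1 hsq).imp
      (sub_mem_lattice_of_weierstrassP_eq_of_derivWeierstrassP_eq ha hb h) fun h' => ?_
    have := sub_mem_lattice_of_weierstrassP_eq_of_derivWeierstrassP_eq (b := -b) ha
      (by rwa [neg_mem_iff]) (by rwa [L.weierstrassP_neg]) (by rwa [L.derivWeierstrassP_neg])
    rwa [sub_neg_eq_add] at this
  · rintro (h | h)
    · exact weierstrassP_eq_of_sub_mem_lattice h
    · rw [← L.weierstrassP_neg b]
      exact weierstrassP_eq_of_sub_mem_lattice (by rwa [sub_neg_eq_add])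

theorem derivWeierstrassP_eq_zero_iff (hz : z ∉ L.lattice) :
    L.derivWeierstrassP z = 0 ↔ 2 * z ∈ L.lattice := by
  have hsub : z - -z = 2 * z := by ring
  rw [← hsub]
  refine ⟨fun h => ?_, fun h => ?_⟩
  · exact sub_mem_lattice_of_weierstrassP_eq_of_derivWeierstrassP_eq hz (by rwa [neg_mem_iff])
      (L.weierstrassP_neg z).symm (by rw [L.derivWeierstrassP_neg, h, neg_zero])
  · have := derivWeierstrassP_eq_of_sub_mem_lattice h
    rwa [L.derivWeierstrassP_neg, self_eq_neg] at this

end Weierstrass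

section Reciprocal

variable (L : PeriodPair)

theorem eventually_weierstrassP_ne_zero : ∀ᶠ z in 𝓝[≠] 0, L.weierstrassP z ≠ 0 := by
  rw [← meromorphicOrderAt_ne_top_iff_eventually_ne_zero (L.meromorphic_weierstrassP 0)]
  exact (((meromorphicOrderAt_weierstrassP_neg_iff L).2 (zero_mem _)).trans_le le_top).ne

theorem analyticAt_inv_weierstrassP_zero : AnalyticAt ℂ L.weierstrassP⁻¹ 0 := by
  have hNF := (meromorphicNFOn_weierstrassP L (Set.mem_univ 0)).inv
  rw [← hNF.meromorphicOrderAt_nonneg_iff_analyticAt, meromorphicOrderAt_inv,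
    L.order_weierstrassP 0 (zero_mem _)]
  decide

theorem deriv_inv_weierstrassP_zero : deriv L.weierstrassP⁻¹ 0 = 0 := by
  have heven : (fun z => L.weierstrassP⁻¹ (-z)) = L.weierstrassP⁻¹ := by
    ext z
    simp
  have := deriv_comp_neg L.weierstrassP⁻¹ 0
  rwa [heven, neg_zero, self_eq_neg] at this

theorem eventually_hasDerivAt_inv_weierstrassP :
    ∀ᶠ z in 𝓝 0, HasDerivAt L.weierstrassP⁻¹ (deriv L.weierstrassP⁻¹ z) z :=
  (analyticAt_inv_weierstrassP_zero L).eventually_analyticAt.mono fun _ h =>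
    h.differentiableAt.hasDerivAt

theorem eventually_deriv_inv_weierstrassP : ∀ᶠ z in 𝓝[≠] 0,
    deriv L.weierstrassP⁻¹ z = -L.derivWeierstrassP z / L.weierstrassP z ^ 2 := by
  filter_upwards [eventually_weierstrassP_ne_zero L, eventually_notMem_lattice L 0] with z hz0 hz
  exact ((hasDerivAt_weierstrassP hz).inv hz0).deriv

theorem eventually_deriv_inv_weierstrassP_sq : ∀ᶠ z in 𝓝 0,
    deriv L.weierstrassP⁻¹ z ^ 2 = 4 * L.weierstrassP⁻¹ z - L.g₂ * L.weierstrassP⁻¹ z ^ 3 -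
      L.g₃ * L.weierstrassP⁻¹ z ^ 4 := by
  have hQ := analyticAt_inv_weierstrassP_zero L
  refine (ContinuousAt.eventuallyEq_nhds_iff_eventuallyEq_nhdsNE
    (hQ.deriv.continuousAt.fun_pow 2) (by fun_prop)).1 ?_
  filter_upwards [eventually_deriv_inv_weierstrassP L, eventually_weierstrassP_ne_zero L,
    eventually_notMem_lattice L 0] with z hderiv hz0 hz
  rw [hderiv, Pi.inv_apply, div_pow, neg_sq, L.derivWeierstrassP_sq z hz]
  field_simp

theorem eventually_hasDerivAt_deriv_inv_weierstrassP : ∀ᶠ z in 𝓝 0,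
    HasDerivAt (deriv L.weierstrassP⁻¹)
      (2 - 3 / 2 * L.g₂ * L.weierstrassP⁻¹ z ^ 2 - 2 * L.g₃ * L.weierstrassP⁻¹ z ^ 3) z := by
  have hQ := analyticAt_inv_weierstrassP_zero L
  suffices h : deriv (deriv L.weierstrassP⁻¹) =ᶠ[𝓝 0] fun z =>
      2 - 3 / 2 * L.g₂ * L.weierstrassP⁻¹ z ^ 2 - 2 * L.g₃ * L.weierstrassP⁻¹ z ^ 3 by
    filter_upwards [h, hQ.deriv.eventually_analyticAt] with z hz hana
    exact hz ▸ hana.differentiableAt.hasDerivAt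
  refine (ContinuousAt.eventuallyEq_nhds_iff_eventuallyEq_nhdsNE
    hQ.deriv.deriv.continuousAt (by fun_prop)).1 ?_
  filter_upwards [eventually_eventually_nhdsWithin.2 (eventually_deriv_inv_weierstrassP L),
    eventually_weierstrassP_ne_zero L, eventually_notMem_lattice L 0, self_mem_nhdsWithin]
    with z hderiv hz0 hz hne
  rw [IsOpen.nhdsWithin_eq isOpen_compl_singleton hne] at hderiv
  rw [EventuallyEq.deriv_eq hderiv, Pi.inv_apply, ((hasDerivAt_derivWeierstrassP hz).fun_neg.fun_div
    ((hasDerivAt_weierstrassP hz).fun_pow 2) (pow_ne_zero 2 hz0)).deriv]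
  field_simp
  push_cast
  linear_combination 4 * L.weierstrassP z * L.derivWeierstrassP_sq z hz

variable {L}

theorem weierstrassP_eq_of_g₂_eq_of_g₃_eq {L' : PeriodPair} (h₂ : L.g₂ = L'.g₂)
    (h₃ : L.g₃ = L'.g₃) : L.weierstrassP = L'.weierstrassP := by
  have hloc : L.weierstrassP⁻¹ =ᶠ[𝓝 0] L'.weierstrassP⁻¹ := by
    have hL' := eventually_hasDerivAt_deriv_inv_weierstrassP L'
    rw [← h₂, ← h₃] at hL'
    exact eventuallyEq_of_hasDerivAt_hasDerivAt
      (φ := fun y => 2 - 3 / 2 * L.g₂ * y ^ 2 - 2 * L.g₃ * y ^ 3) (by fun_prop)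
      (eventually_hasDerivAt_inv_weierstrassP L) (eventually_hasDerivAt_deriv_inv_weierstrassP L)
      (eventually_hasDerivAt_inv_weierstrassP L') hL' (by simp)
      (by rw [deriv_inv_weierstrassP_zero, deriv_inv_weierstrassP_zero])
  exact inv_injective <| eq_of_meromorphicNFOn_univ_of_eventuallyEq_nhdsNE
    (meromorphicNFOn_inv.2 (meromorphicNFOn_weierstrassP L))
    (meromorphicNFOn_inv.2 (meromorphicNFOn_weierstrassP L'))
    (hloc.filter_mono nhdsWithin_le_nhds)

theorem weierstrassP_add_of_eq_zero {h z : ℂ} (hh : h ∉ L.lattice) (h0 : L.weierstrassP h = 0)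
    (h0' : L.derivWeierstrassP h = 0) (hg₂ : L.g₂ ≠ 0) :
    L.weierstrassP (z + h) = -(L.g₂ / 4) * (L.weierstrassP z)⁻¹ := by
  have hg₃ : L.g₃ = 0 := by simpa [h0, h0'] using L.derivWeierstrassP_sq h hh
  have hloc : (fun z => L.weierstrassP (z + h)) =ᶠ[𝓝 0]
      fun z => -(L.g₂ / 4) * L.weierstrassP⁻¹ z := by
    have hQ := (eventually_hasDerivAt_inv_weierstrassP L).mono fun z hz =>
      hz.const_mul (-(L.g₂ / 4))
    have hQ' := (eventually_hasDerivAt_deriv_inv_weierstrassP L).mono fun z hz =>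
      hz.const_mul (-(L.g₂ / 4))
    have hP := eventually_hasDerivAt_weierstrassP_add hh
    refine eventuallyEq_of_hasDerivAt_hasDerivAt (φ := fun y => 6 * y ^ 2 - L.g₂ / 2)
      (by fun_prop) (hP.mono fun _ h => h.1) (hP.mono fun _ h => h.2) hQ
      (hQ'.mono fun z hz => hz.congr_deriv ?_) (by simp [h0])
      (by simp [h0', deriv_inv_weierstrassP_zero])
    rw [hg₃]
    ring
  have hNF : MeromorphicNFOn (fun z => -(L.g₂ / 4) * L.weierstrassP⁻¹ z) Set.univ :=
    fun z _ => (meromorphicNFAt_mul_iff_right analyticAt_const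
      (neg_ne_zero.2 (div_ne_zero hg₂ (by norm_num)))).2
        (meromorphicNFOn_weierstrassP L (Set.mem_univ z)).inv
  exact congrFun (eq_of_meromorphicNFOn_univ_of_eventuallyEq_nhdsNE
    (meromorphicNFOn_weierstrassP_add_const L h) hNF (hloc.filter_mono nhdsWithin_le_nhds)) z

end Reciprocal

section Symmetry

variable {L L' : PeriodPair} {c : ℂ}

theorem weierstrassP_mul (hc : c ≠ 0) (h : ∀ l, c * l ∈ L'.lattice ↔ l ∈ L.lattice) (z : ℂ) :
    L'.weierstrassP (c * z) = (c ^ 2)⁻¹ * L.weierstrassP z := by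
  rw [PeriodPair.weierstrassP, PeriodPair.weierstrassP, ← tsum_mul_left,
    ← ((Equiv.mulLeft₀ c hc).subtypeEquiv fun l => (h l).symm).tsum_eq]
  refine tsum_congr fun l => ?_
  change 1 / (c * z - c * l) ^ 2 - 1 / (c * l) ^ 2 = _
  rw [← mul_sub, mul_sub (c ^ 2)⁻¹]
  simp only [mul_pow, one_div, mul_inv]

theorem G_mul (hc : c ≠ 0) (h : ∀ l, c * l ∈ L'.lattice ↔ l ∈ L.lattice) (k : ℕ) :
    L'.G k = (c ^ k)⁻¹ * L.G k := by
  rw [PeriodPair.G, PeriodPair.G, ← tsum_mul_left,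
    ← ((Equiv.mulLeft₀ c hc).subtypeEquiv fun l => (h l).symm).tsum_eq]
  refine tsum_congr fun l => ?_
  change ((c * l) ^ k)⁻¹ = _
  rw [mul_pow, mul_inv]

theorem weierstrassP_conj (h : ∀ l, conj l ∈ L.lattice ↔ l ∈ L.lattice) (z : ℂ) :
    L.weierstrassP (conj z) = conj (L.weierstrassP z) := by
  rw [PeriodPair.weierstrassP, PeriodPair.weierstrassP, Complex.conj_tsum,
    ← (Complex.conjAe.toEquiv.subtypeEquiv fun l => (h l).symm).tsum_eq]
  refine tsum_congr fun l => ?_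
  change 1 / (conj z - conj (l : ℂ)) ^ 2 - 1 / (conj (l : ℂ)) ^ 2 = _
  simp only [map_sub, map_div₀, map_one, map_pow]

end Symmetry

section SquareLattice

/-- The period pair `(2a, 2ia)`, which spans a square lattice. -/
noncomputable def squarePair (a : ℂ) (ha : a ≠ 0) : PeriodPair where
  ω₁ := 2 * a
  ω₂ := 2 * Complex.I * a
  indep := by
    refine LinearIndependent.pair_iff.2 fun s t h => ?_
    have h0 : (s + t * Complex.I) * (2 * a) = 0 := by
      rw [Complex.real_smul, Complex.real_smul] at h
      linear_combination h
    have h0' := (mul_eq_zero.1 h0).resolve_right (mul_ne_zero two_ne_zero ha)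
    simpa using And.intro (congrArg Complex.re h0') (congrArg Complex.im h0')

theorem mem_lattice_squarePair {a : ℂ} (ha : a ≠ 0) {z : ℂ} :
    z ∈ (squarePair a ha).lattice ↔ ∃ m n : ℤ, z = 2 * (m + n * Complex.I) * a := by
  rw [PeriodPair.mem_lattice]
  refine exists₂_congr fun m n => ?_
  rw [eq_comm]
  congr! 1
  rw [squarePair]
  ring

theorem mul_mem_lattice_squarePair {a c : ℂ} (ha : a ≠ 0) (hc : c ≠ 0) (l : ℂ) :
    c * l ∈ (squarePair (c * a) (mul_ne_zero hc ha)).lattice ↔ l ∈ (squarePair a ha).lattice := by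
  simp only [mem_lattice_squarePair]
  refine exists₂_congr fun m n => ?_
  rw [mul_left_comm, mul_right_inj' hc]

theorem I_mul_mem_lattice_squarePair {a : ℂ} (ha : a ≠ 0) (l : ℂ) :
    Complex.I * l ∈ (squarePair a ha).lattice ↔ l ∈ (squarePair a ha).lattice := by
  simp only [mem_lattice_squarePair]
  constructor
  · rintro ⟨m, n, h⟩
    refine ⟨n, -m, ?_⟩
    push_cast
    linear_combination -Complex.I * h + (l - 2 * n * a) * Complex.I_sq
  · rintro ⟨m, n, rfl⟩
    refine ⟨-n, m, ?_⟩
    push_cast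
    linear_combination 2 * n * a * Complex.I_sq

theorem conj_mem_lattice_squarePair {a : ℂ} (ha : a ≠ 0) (har : conj a = a) (l : ℂ) :
    conj l ∈ (squarePair a ha).lattice ↔ l ∈ (squarePair a ha).lattice := by
  have hconj {z : ℂ} (hz : z ∈ (squarePair a ha).lattice) :
      conj z ∈ (squarePair a ha).lattice := by
    rw [mem_lattice_squarePair] at hz ⊢
    obtain ⟨m, n, rfl⟩ := hz
    exact ⟨m, -n, by simp [har, Complex.conj_ofNat]⟩
  exact ⟨fun h => by simpa using hconj h, hconj⟩

theorem g₃_squarePair {a : ℂ} (ha : a ≠ 0) : (squarePair a ha).g₃ = 0 := by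
  have hG := G_mul Complex.I_ne_zero (I_mul_mem_lattice_squarePair ha) 6
  rw [show Complex.I ^ 6 = -1 by rw [Complex.I_pow_eq_pow_mod]; simp, inv_neg_one, neg_one_mul,
    CharZero.eq_neg_self_iff] at hG
  rw [PeriodPair.g₃, hG, mul_zero]

/-- The centre `(1 + i) a` of the square with vertices `0, 2a, 2a + 2ia, 2ia`. -/
noncomputable def squareCentre (a : ℂ) : ℂ := (1 + Complex.I) * a

section

variable {a : ℂ} (ha : a ≠ 0)

theorem mul_mem_lattice_squarePair_iff {α β : ℚ} :
    (α + β * Complex.I) * (2 * a) ∈ (squarePair a ha).lattice ↔ α.den = 1 ∧ β.den = 1 := by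
  rw [← (squarePair a ha).mul_ω₁_add_mul_ω₂_mem_lattice]
  congr! 1
  rw [squarePair]
  ring

theorem two_mul_mem_lattice_squarePair : 2 * a ∈ (squarePair a ha).lattice :=
  (squarePair a ha).ω₁_mem_lattice

theorem notMem_lattice_squarePair : a ∉ (squarePair a ha).lattice := by
  have := (squarePair a ha).ω₁_div_two_notMem_lattice
  rwa [squarePair, mul_div_cancel_left₀ a two_ne_zero] at this

theorem squareCentre_notMem_lattice : squareCentre a ∉ (squarePair a ha).lattice := by
  have := (mul_mem_lattice_squarePair_iff ha (α := 1 / 2) (β := 1 / 2)).not.2 (by norm_num)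
  push_cast at this
  rw [squareCentre]
  convert this using 2
  ring

theorem two_mul_squareCentre_mem_lattice : 2 * squareCentre a ∈ (squarePair a ha).lattice :=
  (mem_lattice_squarePair ha).2 ⟨1, 1, by rw [squareCentre]; push_cast; ring⟩

theorem weierstrassP_squarePair_I_mul (z : ℂ) :
    (squarePair a ha).weierstrassP (Complex.I * z) = -(squarePair a ha).weierstrassP z := by
  rw [weierstrassP_mul Complex.I_ne_zero (I_mul_mem_lattice_squarePair ha), Complex.I_sq,
    inv_neg_one, neg_one_mul]

theorem weierstrassP_squareCentre : (squarePair a ha).weierstrassP (squareCentre a) = 0 := by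
  have hrot := weierstrassP_squarePair_I_mul ha (squareCentre a)
  rwa [weierstrassP_eq_of_sub_mem_lattice (b := squareCentre a), CharZero.eq_neg_self_iff] at hrot
  rw [mem_lattice_squarePair]
  refine ⟨-1, 0, ?_⟩
  rw [squareCentre]
  push_cast
  linear_combination a * Complex.I_sq

theorem derivWeierstrassP_squareCentre :
    (squarePair a ha).derivWeierstrassP (squareCentre a) = 0 :=
  (derivWeierstrassP_eq_zero_iff (squareCentre_notMem_lattice ha)).2
    (two_mul_squareCentre_mem_lattice ha)

theorem derivWeierstrassP_squarePair_self : (squarePair a ha).derivWeierstrassP a = 0 :=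
  (derivWeierstrassP_eq_zero_iff (notMem_lattice_squarePair ha)).2
    (two_mul_mem_lattice_squarePair ha)

theorem weierstrassP_squarePair_self_ne_zero : (squarePair a ha).weierstrassP a ≠ 0 := by
  rw [← weierstrassP_squareCentre ha, Ne, weierstrassP_eq_weierstrassP_iff
    (notMem_lattice_squarePair ha) (squareCentre_notMem_lattice ha)]
  have hsub := (mul_mem_lattice_squarePair_iff ha (α := 0) (β := -1 / 2)).not.2 (by norm_num)
  have hadd := (mul_mem_lattice_squarePair_iff ha (α := 1) (β := 1 / 2)).not.2 (by norm_num)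
  push_cast at hsub hadd
  rintro (h | h) <;> rw [squareCentre] at h
  · exact hsub (by convert h using 1; ring)
  · exact hadd (by convert h using 1; ring)

theorem g₂_squarePair :
    (squarePair a ha).g₂ = 4 * (squarePair a ha).weierstrassP a ^ 2 := by
  have h := (squarePair a ha).derivWeierstrassP_sq a (notMem_lattice_squarePair ha)
  rw [derivWeierstrassP_squarePair_self, g₃_squarePair] at h
  refine mul_left_cancel₀ (weierstrassP_squarePair_self_ne_zero ha) ?_
  linear_combination h

theorem g₂_squarePair_mul {c : ℂ} (hc : c ≠ 0) :
    (squarePair (c * a) (mul_ne_zero hc ha)).g₂ = (c ^ 4)⁻¹ * (squarePair a ha).g₂ := by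
  rw [PeriodPair.g₂, G_mul hc (mul_mem_lattice_squarePair ha hc), PeriodPair.g₂]
  ring

end

theorem ofReal_re_weierstrassP_squarePair {a : ℂ} (ha : a ≠ 0) (har : conj a = a) (t : ℝ) :
    (((squarePair a ha).weierstrassP t).re : ℂ) = (squarePair a ha).weierstrassP t :=
  Complex.conj_eq_iff_re.1 <| by
    rw [← weierstrassP_conj (conj_mem_lattice_squarePair ha har), Complex.conj_ofReal]

theorem exists_pos_isLemniscatic_squarePair :
    ∃ (a : ℝ) (ha : 0 < a), IsLemniscatic (squarePair a (Complex.ofReal_ne_zero.2 ha.ne')) := by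
  obtain ⟨e, he⟩ : ∃ e : ℝ, (squarePair 1 one_ne_zero).weierstrassP 1 = e :=
    ⟨_, by simpa using (ofReal_re_weierstrassP_squarePair one_ne_zero (map_one conj) 1).symm⟩
  have he0 : e ≠ 0 := by
    rintro rfl
    exact weierstrassP_squarePair_self_ne_zero one_ne_zero he
  have hr0 : (√(2 * |e|) : ℂ) ≠ 0 := by simpa using he0
  have hr : (√(2 * |e|) : ℂ) ^ 4 = 4 * e ^ 2 := by
    norm_cast
    rw [show 4 = 2 * 2 from rfl, pow_mul, Real.sq_sqrt (by positivity), mul_pow, sq_abs]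
    norm_num
  have hg₂ := g₂_squarePair_mul one_ne_zero hr0
  rw [g₂_squarePair one_ne_zero, he, hr, inv_mul_cancel₀ (by simpa using he0)] at hg₂
  simp only [mul_one] at hg₂
  exact ⟨√(2 * |e|), by positivity, hg₂, g₃_squarePair hr0⟩

end SquareLattice

section ArcLength

/-- The integral `∫₀ˣ dτ / √(1 + τ⁴)`, the inverse function of the solution of `y' = √(1 + y⁴)`,
`y(0) = 0`. -/
noncomputable def arc (x : ℝ) : ℝ := ∫ τ in (0 : ℝ)..x, 1 / √(1 + τ ^ 4)

theorem sqrt_one_add_pow_four_pos (x : ℝ) : 0 < √(1 + x ^ 4) := Real.sqrt_pos.2 (by positivity)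

theorem hasDerivAt_arc (x : ℝ) : HasDerivAt arc (1 / √(1 + x ^ 4)) x := by
  have hc : Continuous fun τ : ℝ => 1 / √(1 + τ ^ 4) :=
    continuous_const.div (by fun_prop) fun τ => (sqrt_one_add_pow_four_pos τ).ne'
  exact (hc.integral_hasStrictDerivAt 0 x).hasDerivAt

theorem arc_zero : arc 0 = 0 := intervalIntegral.integral_same

theorem strictMono_arc : StrictMono arc := strictMono_of_deriv_pos fun x => by
  rw [(hasDerivAt_arc x).deriv]
  exact one_div_pos.2 (sqrt_one_add_pow_four_pos x)

theorem omega_pos : 0 < omega := by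
  have h := strictMono_arc zero_lt_one
  rw [arc_zero] at h
  exact mul_pos two_pos h

theorem arc_eq_of_hasDerivAt {y : ℝ → ℝ} {σ p q t₀ : ℝ} {l : Filter ℝ} [l.NeBot] (hl : l ≤ 𝓝 t₀)
    (hIoo : Set.Ioo p q ∈ l) (hy : ∀ t ∈ Set.Ioo p q, HasDerivAt y (σ * √(1 + y t ^ 4)) t)
    (h0 : Tendsto y l (𝓝 0)) {t : ℝ} (ht : t ∈ Set.Ioo p q) : arc (y t) = σ * (t - t₀) := by
  have hderiv : ∀ s ∈ Set.Ioo p q, HasDerivAt (fun s => arc (y s) - σ * (s - t₀)) 0 s := by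
    intro s hs
    refine (((hasDerivAt_arc (y s)).comp s (hy s hs)).sub
      (((hasDerivAt_id s).sub_const t₀).const_mul σ)).congr_deriv ?_
    have := (sqrt_one_add_pow_four_pos (y s)).ne'
    field_simp
    ring
  have hconst : ∀ᶠ s in l, arc (y s) - σ * (s - t₀) = arc (y t) - σ * (t - t₀) :=
    mem_of_superset hIoo fun s hs => isOpen_Ioo.is_const_of_deriv_eq_zero isPreconnected_Ioo
      (fun r hr => (hderiv r hr).differentiableAt.differentiableWithinAt)
      (fun r hr => (hderiv r hr).deriv) hs ht
  have hlim : Tendsto (fun s => arc (y s) - σ * (s - t₀)) l (𝓝 (arc 0 - σ * (t₀ - t₀))) :=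
    ((hasDerivAt_arc 0).continuousAt.tendsto.comp h0).sub
      (((tendsto_id.mono_right hl).sub_const t₀).const_mul σ)
  rw [arc_zero, sub_self, mul_zero, sub_zero] at hlim
  have hlim' := tendsto_const_nhds.congr' (hconst.mono fun _ => Eq.symm)
  exact sub_eq_zero.1 (tendsto_nhds_unique hlim' hlim)

theorem hasDerivAt_inv_of_hasDerivAt_sqrt {y : ℝ → ℝ} {t : ℝ} (h : HasDerivAt y √(1 + y t ^ 4) t)
    (hy : y t ≠ 0) : HasDerivAt y⁻¹ (-√(1 + y⁻¹ t ^ 4)) t := by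
  refine (h.inv hy).congr_deriv ?_
  have hsqrt : √(1 + y t ^ 4) = y t ^ 2 * √(1 + y⁻¹ t ^ 4) := by
    rw [← Real.sqrt_sq (sq_nonneg (y t)), ← Real.sqrt_mul (by positivity), Pi.inv_apply]
    congr 1
    field_simp
    ring
  rw [hsqrt]
  field_simp

theorem tendsto_zero_of_sq {α : Type*} {l : Filter α} {y : α → ℝ}
    (h : Tendsto (fun t => y t ^ 2) l (𝓝 0)) : Tendsto y l (𝓝 0) := by
  rw [tendsto_zero_iff_abs_tendsto_zero]
  simpa [Function.comp_def, Real.sqrt_sq_eq_abs] using h.sqrt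

/-- A real solution of `x'² = 4x³ - x` on `(0, a]` that comes from `+∞` at `0` and turns at `a`
for the first time, like the lemniscatic `℘` on its real half-period. -/
structure IsDescent (a : ℝ) (x x' : ℝ → ℝ) : Prop where
  hasDerivAt : ∀ t ∈ Set.Ioc 0 a, HasDerivAt x (x' t) t
  hasDerivAt_deriv : ∀ t ∈ Set.Ioc 0 a, HasDerivAt x' (6 * x t ^ 2 - 1 / 2) t
  deriv_sq : ∀ t ∈ Set.Ioc 0 a, x' t ^ 2 = 4 * x t ^ 3 - x t
  deriv_ne_zero : ∀ t ∈ Set.Ioo 0 a, x' t ≠ 0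
  deriv_right : x' a = 0
  tendsto_atTop : Tendsto x (𝓝[>] 0) atTop

/-- The coordinate `y = -x' / (2 (x² - 1/4))`, in which `x'² = 4x³ - x` becomes `y'² = 1 + y⁴`. -/
noncomputable def arcCoordinate (x x' : ℝ → ℝ) (t : ℝ) : ℝ := -x' t / (2 * (x t ^ 2 - 1 / 4))

namespace IsDescent

variable {a : ℝ} {x x' : ℝ → ℝ} (h : IsDescent a x x')
include h

theorem continuousOn : ContinuousOn x (Set.Ioc 0 a) := fun t ht =>
  (h.hasDerivAt t ht).continuousAt.continuousWithinAt

theorem half_lt {t : ℝ} (ht : t ∈ Set.Ioo 0 a) : 1 / 2 < x t := by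
  by_contra! hle
  have hpos : 0 < a := ht.1.trans ht.2
  obtain ⟨s, hs, hxs⟩ : (1 / 2 : ℝ) ∈ x '' Set.Ioo 0 a :=
    isPreconnected_Ioo.intermediate_value_Ici ht
      (le_principal_iff.2 (Ioo_mem_nhdsGT hpos)) (h.continuousOn.mono Set.Ioo_subset_Ioc_self)
      h.tendsto_atTop hle
  refine h.deriv_ne_zero s hs (pow_eq_zero_iff two_ne_zero |>.1 ?_)
  rw [h.deriv_sq s (Set.Ioo_subset_Ioc_self hs), hxs]
  norm_num

theorem apply_right (ha : 0 < a) : x a = 1 / 2 := by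
  have ha_mem : a ∈ Set.Ioc 0 a := Set.right_mem_Ioc.2 ha
  have hge : 1 / 2 ≤ x a := ge_of_tendsto
    ((h.hasDerivAt a ha_mem).continuousAt.tendsto.mono_left (nhdsWithin_le_nhds (s := Set.Iio a)))
    (mem_of_superset (Ioo_mem_nhdsLT ha) fun t ht => (h.half_lt ht).le)
  have hroot : x a * (x a + 1 / 2) * (x a - 1 / 2) = 0 := by
    have := h.deriv_sq a ha_mem
    rw [h.deriv_right] at this
    linear_combination -this / 4
  have hne : x a * (x a + 1 / 2) ≠ 0 := by positivity
  linarith [(mul_eq_zero.1 hroot).resolve_left hne]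

theorem sq_sub_pos {t : ℝ} (ht : t ∈ Set.Ioo 0 a) : 0 < x t ^ 2 - 1 / 4 := by
  nlinarith [h.half_lt ht]

theorem arcCoordinate_sq {t : ℝ} (ht : t ∈ Set.Ioo 0 a) :
    arcCoordinate x x' t ^ 2 = x t / (x t ^ 2 - 1 / 4) := by
  have hpos := h.sq_sub_pos ht
  rw [arcCoordinate, div_pow, neg_sq, h.deriv_sq t (Set.Ioo_subset_Ioc_self ht),
    div_eq_div_iff (by positivity) hpos.ne']
  ring

theorem hasDerivAt_arcCoordinate {t : ℝ} (ht : t ∈ Set.Ioo 0 a) :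
    HasDerivAt (arcCoordinate x x') √(1 + arcCoordinate x x' t ^ 4) t := by
  have hpos := h.sq_sub_pos ht
  have ht' := Set.Ioo_subset_Ioc_self ht
  have hsqrt : √(1 + arcCoordinate x x' t ^ 4) = (x t ^ 2 + 1 / 4) / (x t ^ 2 - 1 / 4) := by
    rw [show 4 = 2 * 2 from rfl, pow_mul, h.arcCoordinate_sq ht,
      Real.sqrt_eq_iff_mul_self_eq_of_pos (by positivity)]
    have hne := hpos.ne'
    generalize hd : x t ^ 2 - 1 / 4 = d at hne ⊢
    field_simp
    linear_combination 16 * (x t ^ 2 - 1 / 4 + d) * hd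
  rw [hsqrt]
  refine ((h.hasDerivAt_deriv t ht').fun_neg.fun_div
    ((((h.hasDerivAt t ht').fun_pow 2).sub_const (1 / 4)).const_mul 2)
      (mul_pos two_pos hpos).ne').congr_deriv ?_
  rw [div_eq_div_iff (by positivity) hpos.ne']
  push_cast
  linear_combination 4 * x t * (x t ^ 2 - 1 / 4) * h.deriv_sq t ht'

theorem arcCoordinate_ne_zero {t : ℝ} (ht : t ∈ Set.Ioo 0 a) : arcCoordinate x x' t ≠ 0 :=
  div_ne_zero (neg_ne_zero.2 (h.deriv_ne_zero t ht)) (mul_pos two_pos (h.sq_sub_pos ht)).ne'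

theorem tendsto_arcCoordinate_left (ha : 0 < a) :
    Tendsto (arcCoordinate x x') (𝓝[>] 0) (𝓝 0) := by
  refine tendsto_zero_of_sq (squeeze_zero' (g := fun t => 2 * (x t)⁻¹)
    (.of_forall fun t => sq_nonneg _) ?_ ?_)
  · filter_upwards [Ioo_mem_nhdsGT ha, h.tendsto_atTop.eventually_ge_atTop 1] with t ht hx
    rw [h.arcCoordinate_sq ht, ← div_eq_mul_inv, div_le_div_iff₀ (h.sq_sub_pos ht) (by linarith)]
    nlinarith
  · simpa using h.tendsto_atTop.inv_tendsto_atTop.const_mul 2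

theorem tendsto_inv_arcCoordinate_right (ha : 0 < a) :
    Tendsto (arcCoordinate x x')⁻¹ (𝓝[<] a) (𝓝 0) := by
  have hcont := (h.hasDerivAt a (Set.right_mem_Ioc.2 ha)).continuousAt
  have hlim : ContinuousAt (fun t => (x t ^ 2 - 1 / 4) / x t) a :=
    ((hcont.pow 2).sub_const _).div hcont (by rw [h.apply_right ha]; norm_num)
  refine tendsto_zero_of_sq (((hlim.tendsto.mono_left nhdsWithin_le_nhds).congr' ?_).trans ?_)
  · filter_upwards [Ioo_mem_nhdsLT ha] with t ht
    rw [Pi.inv_apply, inv_pow, h.arcCoordinate_sq ht, inv_div]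
  · rw [h.apply_right ha]
    norm_num

theorem arc_arcCoordinate {t : ℝ} (ht : t ∈ Set.Ioo 0 a) : arc (arcCoordinate x x' t) = t := by
  have ha : 0 < a := ht.1.trans ht.2
  simpa using arc_eq_of_hasDerivAt (σ := 1) nhdsWithin_le_nhds (Ioo_mem_nhdsGT ha)
    (fun s hs => by simpa using h.hasDerivAt_arcCoordinate hs) (h.tendsto_arcCoordinate_left ha) ht

theorem arc_inv_arcCoordinate {t : ℝ} (ht : t ∈ Set.Ioo 0 a) :
    arc (arcCoordinate x x' t)⁻¹ = a - t := by
  have ha : 0 < a := ht.1.trans ht.2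
  have hinv : ∀ s ∈ Set.Ioo 0 a, HasDerivAt (arcCoordinate x x')⁻¹
      (-1 * √(1 + (arcCoordinate x x')⁻¹ s ^ 4)) s := fun s hs => by
    rw [neg_one_mul]
    exact hasDerivAt_inv_of_hasDerivAt_sqrt (h.hasDerivAt_arcCoordinate hs)
      (h.arcCoordinate_ne_zero hs)
  simpa using arc_eq_of_hasDerivAt nhdsWithin_le_nhds (Ioo_mem_nhdsLT ha) hinv
    (h.tendsto_inv_arcCoordinate_right ha) ht

theorem exists_arcCoordinate_eq_one (ha : 0 < a) : ∃ t ∈ Set.Ioo 0 a, arcCoordinate x x' t = 1 := by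
  have hsqrt := Real.sqrt_pos.2 two_pos
  obtain ⟨t, ht, hxt⟩ : (1 + √2) / 2 ∈ x '' Set.Ioc 0 a :=
    isPreconnected_Ioc.intermediate_value_Ici (Set.right_mem_Ioc.2 ha)
      (le_principal_iff.2 (Ioc_mem_nhdsGT ha)) h.continuousOn h.tendsto_atTop
      (by rw [Set.mem_Ici, h.apply_right ha]; linarith)
  have hta : t ≠ a := by
    rintro rfl
    rw [h.apply_right ha] at hxt
    linarith
  have ht' : t ∈ Set.Ioo 0 a := ⟨ht.1, ht.2.lt_of_ne hta⟩
  have hsq : arcCoordinate x x' t ^ 2 = 1 := by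
    rw [h.arcCoordinate_sq ht', div_eq_one_iff_eq (h.sq_sub_pos ht').ne', hxt]
    linear_combination -(1 / 4) * Real.sq_sqrt zero_le_two
  have hpos : 0 < arcCoordinate x x' t := by
    rw [← strictMono_arc.lt_iff_lt, arc_zero, h.arc_arcCoordinate ht']
    exact ht.1
  exact ⟨t, ht', (pow_eq_one_iff_of_nonneg hpos.le two_ne_zero).1 hsq⟩

theorem eq_omega (ha : 0 < a) : a = omega := by
  obtain ⟨t, ht, hone⟩ := h.exists_arcCoordinate_eq_one ha
  have h₁ := h.arc_arcCoordinate ht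
  have h₂ := h.arc_inv_arcCoordinate ht
  rw [hone] at h₁ h₂
  rw [inv_one] at h₂
  have homega : omega = 2 * arc 1 := rfl
  linarith

end IsDescent

end ArcLength

section RealPeriod

theorem tendsto_sq_mul_weierstrassP (L : PeriodPair) :
    Tendsto (fun z => z ^ 2 * L.weierstrassP z) (𝓝[≠] 0) (𝓝 1) := by
  have hcont : ContinuousAt (fun z => z ^ 2 * L.weierstrassPExcept 0 z + 1) 0 := by
    have := (L.analyticAt_weierstrassPExcept 0).continuousAt
    fun_prop
  refine ((hcont.tendsto.mono_left nhdsWithin_le_nhds).congr' ?_).trans_eq (by simp)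
  filter_upwards [self_mem_nhdsWithin] with z (hz : z ≠ 0)
  have hexcept : L.weierstrassPExcept 0 z + 1 / z ^ 2 = L.weierstrassP z := by
    simpa using L.weierstrassPExcept_add 0 z
  rw [← hexcept]
  field_simp

theorem tendsto_ofReal_nhdsGT_zero : Tendsto ((↑) : ℝ → ℂ) (𝓝[>] 0) (𝓝[≠] 0) :=
  tendsto_nhdsWithin_of_tendsto_nhds_of_eventually_within _
    ((Complex.continuous_ofReal.tendsto' 0 0 Complex.ofReal_zero).mono_left nhdsWithin_le_nhds)
    (eventually_mem_nhdsWithin.mono fun _ ht => Complex.ofReal_ne_zero.2 (Set.mem_Ioi.1 ht).ne')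

theorem tendsto_re_weierstrassP_ofReal_atTop (L : PeriodPair) :
    Tendsto (fun t : ℝ => (L.weierstrassP t).re) (𝓝[>] 0) atTop := by
  have hlim : Tendsto (fun t : ℝ => t ^ 2 * (L.weierstrassP t).re) (𝓝[>] 0) (𝓝 1) := by
    have := (Complex.continuous_re.tendsto 1).comp
      ((tendsto_sq_mul_weierstrassP L).comp tendsto_ofReal_nhdsGT_zero)
    refine this.congr fun t => ?_
    simp only [Function.comp_apply, ← Complex.ofReal_pow, Complex.re_ofReal_mul]
  have hinv : Tendsto (fun t : ℝ => (t ^ 2)⁻¹) (𝓝[>] 0) atTop :=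
    (tendsto_pow_atTop two_ne_zero).comp tendsto_inv_nhdsGT_zero |>.congr fun t => inv_pow t 2
  refine (hlim.pos_mul_atTop one_pos hinv).congr' ?_
  filter_upwards [self_mem_nhdsWithin] with t ht
  have ht0 : t ≠ 0 := (Set.mem_Ioi.1 ht).ne'
  field_simp

theorem ofReal_notMem_lattice_squarePair {a t : ℝ} (ha : (a : ℂ) ≠ 0)
    (ht : t ∈ Set.Ioo 0 (2 * a)) : (t : ℂ) ∉ (squarePair a ha).lattice := by
  rw [mem_lattice_squarePair]
  rintro ⟨m, n, h⟩
  have hre : t = m * (2 * a) := by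
    have := congrArg Complex.re h
    simp only [Complex.ofReal_re, Complex.mul_re, Complex.re_ofNat, Complex.add_re,
      Complex.intCast_re, Complex.I_re, mul_zero, Complex.intCast_im, Complex.I_im, mul_one,
      sub_self, add_zero, Complex.im_ofNat, Complex.add_im, Complex.mul_im, zero_add, zero_mul,
      sub_zero, Complex.ofReal_im] at this
    linarith
  have hpos : 0 < 2 * a := ht.1.trans ht.2
  have hm0 : (0 : ℝ) < m := pos_of_mul_pos_left (hre ▸ ht.1) hpos.le
  have hm1 : (m : ℝ) < 1 := (mul_lt_iff_lt_one_left hpos).1 (hre ▸ ht.2)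
  norm_cast at hm0 hm1
  omega

theorem ofReal_re_derivWeierstrassP_squarePair {a : ℂ} (ha : a ≠ 0) (har : conj a = a) {t : ℝ}
    (ht : (t : ℂ) ∉ (squarePair a ha).lattice) :
    (((squarePair a ha).derivWeierstrassP t).re : ℂ) = (squarePair a ha).derivWeierstrassP t := by
  have hP := hasDerivAt_weierstrassP ht
  have hre := hP.real_of_complex.ofReal_comp
  simp only [ofReal_re_weierstrassP_squarePair ha har] at hre
  exact hre.unique hP.comp_ofReal

theorem isDescent_of_isLemniscatic_squarePair {a : ℝ} (ha : 0 < a) {ha' : (a : ℂ) ≠ 0}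
    (hL : IsLemniscatic (squarePair a ha')) :
    IsDescent a (fun t => ((squarePair a ha').weierstrassP t).re)
      (fun t => ((squarePair a ha').derivWeierstrassP t).re) := by
  set L := squarePair a ha'
  have har : conj (a : ℂ) = a := Complex.conj_ofReal a
  have hmem {t : ℝ} (ht : t ∈ Set.Ioc 0 a) : (t : ℂ) ∉ L.lattice :=
    ofReal_notMem_lattice_squarePair ha' ⟨ht.1, by linarith [ht.2]⟩
  have hre {t : ℝ} : (((L.weierstrassP t).re : ℝ) : ℂ) = L.weierstrassP t :=
    ofReal_re_weierstrassP_squarePair ha' har t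
  have hre' {t : ℝ} (ht : t ∈ Set.Ioc 0 a) :
      (((L.derivWeierstrassP t).re : ℝ) : ℂ) = L.derivWeierstrassP t :=
    ofReal_re_derivWeierstrassP_squarePair ha' har (hmem ht)
  refine ⟨fun t ht => (hasDerivAt_weierstrassP (hmem ht)).real_of_complex, fun t ht => ?_,
    fun t ht => ?_, fun t ht h0 => ?_, ?_, tendsto_re_weierstrassP_ofReal_atTop L⟩
  · refine (hasDerivAt_derivWeierstrassP (hmem ht)).real_of_complex.congr_deriv ?_
    rw [hL.1, ← hre, ← Complex.ofReal_re (6 * _ ^ 2 - 1 / 2)]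
    push_cast
    rfl
  · have h := L.derivWeierstrassP_sq t (hmem ht)
    rw [hL.1, hL.2, ← hre, ← hre' ht] at h
    norm_cast at h
    simpa using h
  · have ht' := Set.Ioo_subset_Ioc_self ht
    have hzero : L.derivWeierstrassP t = 0 := by rw [← hre' ht', h0, Complex.ofReal_zero]
    have h2t := (derivWeierstrassP_eq_zero_iff (hmem ht')).1 hzero
    refine ofReal_notMem_lattice_squarePair (t := 2 * t) ha'
      ⟨by linarith [ht.1], by linarith [ht.2]⟩ ?_
    exact_mod_cast h2t
  · rw [derivWeierstrassP_squarePair_self, Complex.zero_re]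

end RealPeriod

section PolePoints

theorem ofReal_omega_ne_zero : (omega : ℂ) ≠ 0 := Complex.ofReal_ne_zero.2 omega_pos.ne'

theorem isLemniscatic_squarePair_omega : IsLemniscatic (squarePair omega ofReal_omega_ne_zero) := by
  obtain ⟨a, ha, hL⟩ := exists_pos_isLemniscatic_squarePair
  obtain rfl := (isDescent_of_isLemniscatic_squarePair ha hL).eq_omega ha
  exact hL

theorem mem_polePoints_iff {z : ℂ} : z ∈ polePoints ↔
    2 * z + squareCentre omega ∈ (squarePair omega ofReal_omega_ne_zero).lattice := by
  rw [mem_lattice_squarePair]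
  constructor
  · have heven : ∀ c ∈ ({1, -1} : Set ℂ), ∃ k : ℤ, c + 1 = 2 * k := by
      rintro c (rfl | rfl)
      exacts [⟨1, by norm_num⟩, ⟨0, by norm_num⟩]
    rintro ⟨a, ha, b, hb, m, n, rfl⟩
    obtain ⟨j, hj⟩ := heven a ha
    obtain ⟨k, hk⟩ := heven b hb
    refine ⟨j + 2 * m, k + 2 * n, ?_⟩
    rw [squareCentre]
    push_cast
    linear_combination (hj + Complex.I * hk) * omega
  · have hsign : ∀ k : ℤ, ∃ c ∈ ({1, -1} : Set ℂ), ∃ m : ℤ, 2 * (k : ℂ) = c + 1 + 4 * m := by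
      intro k
      obtain ⟨m, rfl | rfl⟩ := k.even_or_odd'
      exacts [⟨-1, by simp, m, by push_cast; ring⟩, ⟨1, by simp, m, by push_cast; ring⟩]
    rintro ⟨j, k, h⟩
    obtain ⟨a, ha, m, hm⟩ := hsign j
    obtain ⟨b, hb, n, hn⟩ := hsign k
    refine ⟨a, ha, b, hb, m, n, ?_⟩
    rw [squareCentre] at h
    linear_combination (h + (hm + Complex.I * hn) * omega) / 2

variable {L : PeriodPair}

namespace IsLemniscatic

variable (hL : IsLemniscatic L)
include hL

theorem weierstrassP_eq :
    L.weierstrassP = (squarePair omega ofReal_omega_ne_zero).weierstrassP :=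
  weierstrassP_eq_of_g₂_eq_of_g₃_eq (hL.1.trans isLemniscatic_squarePair_omega.1.symm)
    (hL.2.trans isLemniscatic_squarePair_omega.2.symm)

theorem lattice_eq : L.lattice = (squarePair omega ofReal_omega_ne_zero).lattice :=
  lattice_eq_of_weierstrassP_eq L hL.weierstrassP_eq

theorem g₂_ne_zero : L.g₂ ≠ 0 := hL.1 ▸ one_ne_zero

theorem weierstrassP_add_squareCentre (z : ℂ) :
    L.weierstrassP (z + squareCentre omega) = -(1 / 4) * (L.weierstrassP z)⁻¹ := by
  rw [hL.weierstrassP_eq, weierstrassP_add_of_eq_zero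
    (squareCentre_notMem_lattice ofReal_omega_ne_zero)
    (weierstrassP_squareCentre ofReal_omega_ne_zero)
    (derivWeierstrassP_squareCentre ofReal_omega_ne_zero)
    isLemniscatic_squarePair_omega.g₂_ne_zero, isLemniscatic_squarePair_omega.1]

theorem squareCentre_notMem_lattice : squareCentre omega ∉ L.lattice := by
  rw [hL.lattice_eq]
  exact Lemniscatic.squareCentre_notMem_lattice ofReal_omega_ne_zero

theorem weierstrassP_ne_zero_of_two_mul_add_squareCentre_mem {z : ℂ} (hz : z ∉ L.lattice)
    (h : 2 * z + squareCentre omega ∈ L.lattice) : L.weierstrassP z ≠ 0 := by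
  set ρ := squareCentre omega
  have h2ρ : 2 * ρ ∈ L.lattice := by
    rw [hL.lattice_eq]
    exact two_mul_squareCentre_mem_lattice ofReal_omega_ne_zero
  have hadd : z + ρ ∉ L.lattice := fun hmem => hz (by convert sub_mem h hmem using 1; ring)
  have hsub : z - ρ ∉ L.lattice := fun hmem => hadd (by convert add_mem hmem h2ρ using 1; ring)
  have hρ : L.weierstrassP ρ = 0 := by
    rw [hL.weierstrassP_eq]
    exact weierstrassP_squareCentre ofReal_omega_ne_zero
  rw [← hρ, Ne, weierstrassP_eq_weierstrassP_iff hz hL.squareCentre_notMem_lattice, not_or]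
  exact ⟨hsub, hadd⟩

/- `℘² + 1/4` vanishes where translation by the centre of the square fixes `℘`. -/
theorem weierstrassP_sq_add_eq_zero_iff {z : ℂ} (hz : z ∉ L.lattice) :
    L.weierstrassP z ^ 2 + 1 / 4 = 0 ↔ 2 * z + squareCentre omega ∈ L.lattice := by
  have hsum : z + squareCentre omega + z = 2 * z + squareCentre omega := by ring
  have htrans := hL.weierstrassP_add_squareCentre z
  constructor
  · intro h
    have h0 : L.weierstrassP z ≠ 0 := fun h0 => by norm_num [h0] at h
    have hfix : L.weierstrassP (z + squareCentre omega) = L.weierstrassP z := by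
      rw [htrans, ← div_eq_mul_inv, div_eq_iff h0]
      linear_combination -h
    have hmem : z + squareCentre omega ∉ L.lattice := fun hmem =>
      h0 (hfix ▸ L.weierstrassP_coe ⟨_, hmem⟩)
    rw [← hsum]
    refine ((weierstrassP_eq_weierstrassP_iff hmem hz).1 hfix).resolve_left ?_
    rw [add_sub_cancel_left]
    exact hL.squareCentre_notMem_lattice
  · intro h
    have h0 := hL.weierstrassP_ne_zero_of_two_mul_add_squareCentre_mem hz h
    have hfix : L.weierstrassP (z + squareCentre omega) = L.weierstrassP z := by
      rw [← L.weierstrassP_neg z]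
      exact weierstrassP_eq_of_sub_mem_lattice (by rwa [sub_neg_eq_add, hsum])
    rw [htrans, ← div_eq_mul_inv, div_eq_iff h0] at hfix
    linear_combination -hfix

theorem weierstrassP_sq_add_eq_zero_iff_mem_polePoints {z : ℂ} (hz : z ∉ L.lattice) :
    L.weierstrassP z ^ 2 + 1 / 4 = 0 ↔ z ∈ polePoints := by
  rw [hL.weierstrassP_sq_add_eq_zero_iff hz, mem_polePoints_iff, hL.lattice_eq]

theorem notMem_lattice_of_mem_polePoints {z : ℂ} (hz : z ∈ polePoints) : z ∉ L.lattice := by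
  intro hmem
  rw [mem_polePoints_iff, ← hL.lattice_eq] at hz
  refine hL.squareCentre_notMem_lattice ?_
  convert sub_mem hz (add_mem hmem hmem) using 1
  ring

theorem derivWeierstrassP_ne_zero_of_weierstrassP_sq_add_eq_zero {z : ℂ}
    (hz : z ∉ L.lattice) (h : L.weierstrassP z ^ 2 + 1 / 4 = 0) : L.derivWeierstrassP z ≠ 0 := by
  intro h'
  have hsq := L.derivWeierstrassP_sq z hz
  rw [h', hL.1, hL.2] at hsq
  have h0 : L.weierstrassP z = 0 := by
    linear_combination 2 * L.weierstrassP z * h + hsq / 2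
  norm_num [h0] at h

end IsLemniscatic

end PolePoints

section SimplePoles

theorem meromorphicOrderAt_div_eq_neg_one {𝕜 : Type*} [NontriviallyNormedField 𝕜] [CompleteSpace 𝕜]
    [CharZero 𝕜] {g D : 𝕜 → 𝕜} {z : 𝕜} (hg : AnalyticAt 𝕜 g z) (hgz : g z ≠ 0)
    (hD : AnalyticAt 𝕜 D z) (hDz : D z = 0) (hD' : deriv D z ≠ 0) :
    meromorphicOrderAt (g / D) z = -1 := by
  have hg0 : meromorphicOrderAt g z = 0 := by
    rw [hg.meromorphicOrderAt_eq, hg.analyticOrderAt_eq_zero.2 hgz]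
    rfl
  have hD1 : meromorphicOrderAt D z = 1 := by
    have h := hD.analyticOrderAt_sub_eq_one_of_deriv_ne_zero hD'
    simp only [hDz, sub_zero] at h
    rw [hD.meromorphicOrderAt_eq, h]
    rfl
  rw [meromorphicOrderAt_div hg.meromorphicAt hD.meromorphicAt, hg0, hD1]
  rfl

theorem analyticAt_of_periodic {𝕜 E : Type*} [NontriviallyNormedField 𝕜] [NormedAddCommGroup E]
    [NormedSpace 𝕜 E] {f : 𝕜 → E} {l : 𝕜} (hf : AnalyticAt 𝕜 f 0) (hl : Function.Periodic f l) :
    AnalyticAt 𝕜 f l := by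
  have hshift : AnalyticAt 𝕜 f (l - l) := by rwa [sub_self]
  exact (hshift.fun_comp (f := fun z => z - l) (by fun_prop)).congr
    (Eventually.of_forall fun z => hl.sub_eq z)

variable {f : ℂ → ℂ} {S : Set ℂ}

theorem hasSimplePolesExactlyAt_of_analyticAt (hS : ∀ p ∈ S, meromorphicOrderAt f p = -1)
    (hf : ∀ z ∉ S, AnalyticAt ℂ f z) : HasSimplePolesExactlyAt f S := by
  refine ⟨fun p => ⟨fun hp => ?_, fun hp => by rw [hS p hp]; decide⟩, hS⟩
  by_contra hpS
  exact (hf p hpS).meromorphicOrderAt_nonneg.not_gt hp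

theorem HasSimplePolesExactlyAt.notMem_of_analyticAt {z : ℂ}
    (h : HasSimplePolesExactlyAt f S) (hf : AnalyticAt ℂ f z) : z ∉ S := fun hz =>
  hf.meromorphicOrderAt_nonneg.not_gt ((h.1 z).2 hz)

theorem HasSimplePolesExactlyAt.meromorphicNFOn (h : HasSimplePolesExactlyAt f S)
    (hf : ∀ z ∉ S, AnalyticAt ℂ f z) (h0 : ∀ p ∈ S, f p = 0) : MeromorphicNFOn f Set.univ := by
  intro z _
  by_cases hz : z ∈ S
  · exact meromorphicNFAt_iff_analyticAt_or.2 <| .inr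
      ⟨meromorphicAt_of_meromorphicOrderAt_ne_zero ((h.1 z).2 hz).ne, (h.1 z).2 hz, h0 z hz⟩
  · exact (hf z hz).meromorphicNFAt

end SimplePoles

namespace IsLemniscatic

variable {L : PeriodPair} {f g : ℂ → ℂ} {z : ℂ} (hL : IsLemniscatic L)
include hL

theorem meromorphicOrderAt_eq_neg_one_of_eq_div (hz : z ∈ polePoints) (hg : AnalyticAt ℂ g z)
    (hgz : g z ≠ 0) (hf : ∀ x ∉ L.lattice, f x = g x / (L.weierstrassP x ^ 2 + 1 / 4)) :
    meromorphicOrderAt f z = -1 := by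
  have hzL := hL.notMem_lattice_of_mem_polePoints hz
  have hDz := (hL.weierstrassP_sq_add_eq_zero_iff_mem_polePoints hzL).2 hz
  have hD' : HasDerivAt (fun x => L.weierstrassP x ^ 2 + 1 / 4)
      (2 * L.weierstrassP z * L.derivWeierstrassP z) z := by
    simpa using ((hasDerivAt_weierstrassP hzL).fun_pow 2).add_const (1 / 4)
  have hP0 : L.weierstrassP z ≠ 0 := fun h0 => by norm_num [h0] at hDz
  have hfg : f =ᶠ[𝓝[≠] z] g / fun x => L.weierstrassP x ^ 2 + 1 / 4 :=
    (eventually_notMem_lattice L z).mono hf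
  rw [meromorphicOrderAt_congr hfg]
  refine meromorphicOrderAt_div_eq_neg_one hg hgz
    (((L.analyticOnNhd_weierstrassP z hzL).fun_pow 2).add analyticAt_const) hDz ?_
  rw [hD'.deriv]
  exact mul_ne_zero (mul_ne_zero two_ne_zero hP0)
    (hL.derivWeierstrassP_ne_zero_of_weierstrassP_sq_add_eq_zero hzL hDz)

theorem analyticAt_of_eq_div (hper : ∀ l ∈ L.lattice, Function.Periodic f l)
    (h0 : AnalyticAt ℂ f 0) (hg : ∀ z ∉ L.lattice, AnalyticAt ℂ g z)
    (hf : ∀ x ∉ L.lattice, f x = g x / (L.weierstrassP x ^ 2 + 1 / 4)) (hz : z ∉ polePoints) :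
    AnalyticAt ℂ f z := by
  by_cases hzL : z ∈ L.lattice
  · exact analyticAt_of_periodic h0 (hper z hzL)
  have hD : L.weierstrassP z ^ 2 + 1 / 4 ≠ 0 :=
    (hL.weierstrassP_sq_add_eq_zero_iff_mem_polePoints hzL).not.2 hz
  refine ((hg z hzL).fun_div (((L.analyticOnNhd_weierstrassP z hzL).fun_pow 2).add
    analyticAt_const) hD).congr ?_
  exact (eventually_notMem_lattice_of_notMem hzL).mono fun x hx => (hf x hx).symm

theorem isElliptic_and_hasSimplePolesExactlyAt_of_eq_div
    (hper : ∀ l ∈ L.lattice, Function.Periodic f l)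
    (h0 : AnalyticAt ℂ f 0) (hg : ∀ z ∉ L.lattice, AnalyticAt ℂ g z)
    (hg0 : ∀ z ∉ L.lattice, L.weierstrassP z ^ 2 + 1 / 4 = 0 → g z ≠ 0)
    (hf : ∀ x ∉ L.lattice, f x = g x / (L.weierstrassP x ^ 2 + 1 / 4)) :
    IsElliptic (2 * omega) (2 * Complex.I * omega) f ∧ HasSimplePolesExactlyAt f polePoints := by
  have hana : ∀ z ∉ polePoints, AnalyticAt ℂ f z := fun z => hL.analyticAt_of_eq_div hper h0 hg hf
  have hnotMem := fun z => hL.notMem_lattice_of_mem_polePoints (z := z)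
  have hzero : ∀ z ∈ polePoints, L.weierstrassP z ^ 2 + 1 / 4 = 0 := fun z hz =>
    (hL.weierstrassP_sq_add_eq_zero_iff_mem_polePoints (hnotMem z hz)).2 hz
  have hpoles : HasSimplePolesExactlyAt f polePoints :=
    hasSimplePolesExactlyAt_of_analyticAt
      (fun z hz => hL.meromorphicOrderAt_eq_neg_one_of_eq_div hz (hg z (hnotMem z hz))
        (hg0 z (hnotMem z hz) (hzero z hz)) hf) hana
  have hmem {l : ℂ} (hl : l ∈ ({2 * (omega : ℂ), 2 * Complex.I * (omega : ℂ)} : Set ℂ)) :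
      Function.Periodic f l := hper l (hL.lattice_eq ▸ Submodule.subset_span hl)
  refine ⟨⟨(squarePair omega ofReal_omega_ne_zero).indep, hpoles.meromorphicNFOn hana ?_,
    hmem (.inl rfl), hmem (.inr rfl)⟩, hpoles⟩
  intro z hz
  rw [hf z (hnotMem z hz), hzero z hz, div_zero]

end IsLemniscatic

section Extensions

/-- The vector field satisfied by the triple `(sc, s², c²)`. -/
def productField (y : ℂ × ℂ × ℂ) : ℂ × ℂ × ℂ :=
  (y.2.2 ^ 2 - y.2.1 ^ 2, 2 * y.1 * y.2.2, -2 * y.1 * y.2.1)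

theorem contDiff_productField : ContDiff ℂ 1 productField := by
  unfold productField
  fun_prop

theorem IsIVPSolution.hasDerivAt_products {U : Set ℂ} {s c : ℂ → ℂ} (h : IsIVPSolution U s c)
    {z : ℂ} (hz : z ∈ U) : HasDerivAt (fun z => (s z * c z, s z ^ 2, c z ^ 2))
      (productField (s z * c z, s z ^ 2, c z ^ 2)) z := by
  have hs := h.hasDerivAt_s z hz
  have hc := h.hasDerivAt_c z hz
  refine ((hs.fun_mul hc).prodMk ((hs.fun_pow 2).prodMk (hc.fun_pow 2))).congr_deriv ?_
  ext <;> simp only [productField] <;> push_cast <;> ring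

theorem IsIVPSolution.analyticAt {U : Set ℂ} {s c : ℂ → ℂ} (h : IsIVPSolution U s c)
    (hU : IsOpen U) {z : ℂ} (hz : z ∈ U) : AnalyticAt ℂ s z ∧ AnalyticAt ℂ c z :=
  ⟨DifferentiableOn.analyticAt (fun x hx =>
      (h.hasDerivAt_s x hx).differentiableAt.differentiableWithinAt) (hU.mem_nhds hz),
    DifferentiableOn.analyticAt (fun x hx =>
      (h.hasDerivAt_c x hx).differentiableAt.differentiableWithinAt) (hU.mem_nhds hz)⟩

theorem IsElliptic.eqOn_of_eventuallyEq {ω₁ ω₂ a : ℂ} {f g : ℂ → ℂ} {U : Set ℂ}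
    (hf : IsElliptic ω₁ ω₂ f) (hg : AnalyticOnNhd ℂ g U) (hU : IsPreconnected U) (ha : a ∈ U)
    (h : f =ᶠ[𝓝 a] g) : Set.EqOn f g U :=
  eqOn_of_meromorphicNFOn_of_eventuallyEq_nhdsNE (fun z _ => hf.meromorphic (Set.mem_univ z))
    hg.meromorphicNFOn hU ha (h.filter_mono nhdsWithin_le_nhds)

variable (L : PeriodPair)

/-- The elliptic extension of `sc`; its value at the lattice points is right because `℘` and `℘'`
take the value `0` there. -/
noncomputable def scExt (z : ℂ) : ℂ :=
  -(1 / 2) * (L.derivWeierstrassP z / (L.weierstrassP z ^ 2 + 1 / 4))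

/-- The elliptic extension of `s²`; its value at the lattice points is right because `℘` takes the
value `0` there. -/
noncomputable def sSqExt (z : ℂ) : ℂ := L.weierstrassP z / (L.weierstrassP z ^ 2 + 1 / 4)

open Classical in
/-- The elliptic extension of `c²`; its value `1` at the lattice points has to be prescribed, as the
quotient gives `-1` there. -/
noncomputable def cSqExt (z : ℂ) : ℂ :=
  if z ∈ L.lattice then 1 else (L.weierstrassP z ^ 2 - 1 / 4) / (L.weierstrassP z ^ 2 + 1 / 4)

/-- The extensions of `(sc, s², c²)` rewritten in terms of `Q = ℘⁻¹` and `Q'`, which are analytic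
at `0`. -/
noncomputable def extAtZero (z : ℂ) : ℂ × ℂ × ℂ :=
  (1 / 2 * deriv L.weierstrassP⁻¹ z / (1 + L.weierstrassP⁻¹ z ^ 2 / 4),
    L.weierstrassP⁻¹ z / (1 + L.weierstrassP⁻¹ z ^ 2 / 4),
    (1 - L.weierstrassP⁻¹ z ^ 2 / 4) / (1 + L.weierstrassP⁻¹ z ^ 2 / 4))

theorem ext_eventuallyEq_extAtZero :
    (fun z => (scExt L z, sSqExt L z, cSqExt L z)) =ᶠ[𝓝 0] extAtZero L := by
  refine eventuallyEq_nhds_of_eventuallyEq_nhdsNE ?_ ?_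
  · filter_upwards [eventually_deriv_inv_weierstrassP L, eventually_weierstrassP_ne_zero L,
      eventually_notMem_lattice L 0] with z hderiv hz0 hz
    have hD : 1 + (L.weierstrassP z)⁻¹ ^ 2 / 4 =
        (L.weierstrassP z ^ 2 + 1 / 4) / L.weierstrassP z ^ 2 := by
      field_simp
    simp only [extAtZero, hderiv, Pi.inv_apply, hD, div_div_eq_mul_div, scExt, sSqExt, cSqExt,
      if_neg hz]
    refine Prod.ext ?_ (Prod.ext ?_ ?_) <;> simp only <;> field_simp
  · simp [scExt, sSqExt, cSqExt, extAtZero, deriv_inv_weierstrassP_zero]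

theorem eventually_one_add_inv_weierstrassP_sq_div_ne_zero :
    ∀ᶠ z in 𝓝 0, 1 + L.weierstrassP⁻¹ z ^ 2 / 4 ≠ 0 := by
  have hQ := (analyticAt_inv_weierstrassP_zero L).continuousAt
  have hE : ContinuousAt (fun z => 1 + L.weierstrassP⁻¹ z ^ 2 / 4) 0 := by fun_prop
  exact hE.eventually_ne (by simp)

theorem analyticAt_extAtZero : AnalyticAt ℂ (extAtZero L) 0 := by
  have hQ := analyticAt_inv_weierstrassP_zero L
  have hE := (eventually_one_add_inv_weierstrassP_sq_div_ne_zero L).self_of_nhds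
  have hE_ana : AnalyticAt ℂ (fun z => 1 + L.weierstrassP⁻¹ z ^ 2 / 4) 0 := by fun_prop
  exact ((analyticAt_const.mul hQ.deriv).div hE_ana hE).prod
    ((hQ.div hE_ana hE).prod (AnalyticAt.div (by fun_prop) hE_ana hE))

theorem analyticAt_ext_zero :
    AnalyticAt ℂ (scExt L) 0 ∧ AnalyticAt ℂ (sSqExt L) 0 ∧ AnalyticAt ℂ (cSqExt L) 0 := by
  have h := (analyticAt_extAtZero L).congr (ext_eventuallyEq_extAtZero L).symm
  exact ⟨analyticAt_fst.comp h, (analyticAt_fst.comp analyticAt_snd).comp h,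
    (analyticAt_snd.comp analyticAt_snd).comp h⟩

variable {L} {l : ℂ}

theorem scExt_periodic (hl : l ∈ L.lattice) : Function.Periodic (scExt L) l := fun z => by
  rw [scExt, scExt, L.weierstrassP_add_coe z ⟨l, hl⟩, L.derivWeierstrassP_add_coe z ⟨l, hl⟩]

theorem sSqExt_periodic (hl : l ∈ L.lattice) : Function.Periodic (sSqExt L) l := fun z => by
  rw [sSqExt, sSqExt, L.weierstrassP_add_coe z ⟨l, hl⟩]

theorem cSqExt_periodic (hl : l ∈ L.lattice) : Function.Periodic (cSqExt L) l := fun z => by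
  rw [cSqExt, cSqExt, L.weierstrassP_add_coe z ⟨l, hl⟩]
  congr! 1
  exact add_mem_cancel_right hl

namespace IsLemniscatic

variable (hL : IsLemniscatic L)
include hL

theorem eventually_hasDerivAt_extAtZero :
    ∀ᶠ z in 𝓝 0, HasDerivAt (extAtZero L) (productField (extAtZero L z)) z := by
  filter_upwards [eventually_hasDerivAt_inv_weierstrassP L,
    eventually_hasDerivAt_deriv_inv_weierstrassP L, eventually_deriv_inv_weierstrassP_sq L,
    eventually_one_add_inv_weierstrassP_sq_div_ne_zero L] with z hQ hQ' hsq hE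
  rw [hL.1, hL.2] at hQ' hsq
  have hQ2 := (hQ.fun_pow 2).div_const 4
  have hD := hQ2.const_add 1
  refine (((hQ'.const_mul (1 / 2)).fun_div hD hE).prodMk
    ((hQ.fun_div hD hE).prodMk ((hQ2.const_sub 1).fun_div hD hE))).congr_deriv ?_
  simp only [productField, extAtZero]
  generalize L.weierstrassP⁻¹ z = q at *
  generalize deriv L.weierstrassP⁻¹ z = q' at *
  have hq : 4 + q ^ 2 ≠ 0 := fun hq => hE (by linear_combination hq / 4)
  refine Prod.ext ?_ (Prod.ext ?_ ?_) <;> simp only <;> push_cast <;> field_simp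
  · linear_combination -16 * q * hsq
  · ring
  · ring

theorem isElliptic_and_hasSimplePolesExactlyAt_scExt :
    IsElliptic (2 * omega) (2 * Complex.I * omega) (scExt L) ∧
      HasSimplePolesExactlyAt (scExt L) polePoints :=
  hL.isElliptic_and_hasSimplePolesExactlyAt_of_eq_div
    (g := fun z => -(1 / 2) * L.derivWeierstrassP z) (fun _ => scExt_periodic)
    (analyticAt_ext_zero L).1
    (fun z hz => analyticAt_const.mul (L.analyticOnNhd_derivWeierstrassP z hz))
    (fun _ hz hD => mul_ne_zero (by norm_num)
      (hL.derivWeierstrassP_ne_zero_of_weierstrassP_sq_add_eq_zero hz hD))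
    fun _ _ => (mul_div_assoc _ _ _).symm

theorem isElliptic_and_hasSimplePolesExactlyAt_sSqExt :
    IsElliptic (2 * omega) (2 * Complex.I * omega) (sSqExt L) ∧
      HasSimplePolesExactlyAt (sSqExt L) polePoints :=
  hL.isElliptic_and_hasSimplePolesExactlyAt_of_eq_div (fun _ => sSqExt_periodic)
    (analyticAt_ext_zero L).2.1 L.analyticOnNhd_weierstrassP
    (fun _ _ hD h0 => by norm_num [h0] at hD) fun _ _ => rfl

theorem isElliptic_and_hasSimplePolesExactlyAt_cSqExt :
    IsElliptic (2 * omega) (2 * Complex.I * omega) (cSqExt L) ∧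
      HasSimplePolesExactlyAt (cSqExt L) polePoints := by
  refine hL.isElliptic_and_hasSimplePolesExactlyAt_of_eq_div
    (g := fun z => L.weierstrassP z ^ 2 - 1 / 4) (fun _ => cSqExt_periodic)
    (analyticAt_ext_zero L).2.2
    (fun z hz => ((L.analyticOnNhd_weierstrassP z hz).fun_pow 2).sub analyticAt_const)
    (fun _ _ hD h0 => ?_) fun _ hz => if_neg hz
  have hsub : (1 : ℂ) / 2 = 0 := by linear_combination hD - h0
  norm_num at hsub

variable {U : Set ℂ} {s c : ℂ → ℂ} (h : IsIVPSolution U s c) (hU : IsOpen U) (h0 : (0 : ℂ) ∈ U)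
include h hU h0

theorem ext_eventuallyEq : (fun z => (scExt L z, sSqExt L z, cSqExt L z)) =ᶠ[𝓝 0]
    fun z => (s z * c z, s z ^ 2, c z ^ 2) :=
  (ext_eventuallyEq_extAtZero L).trans <|
    eventuallyEq_of_hasDerivAt contDiff_productField.contDiffAt hL.eventually_hasDerivAt_extAtZero
      (eventually_of_mem (hU.mem_nhds h0) fun _ hz => h.hasDerivAt_products hz)
      (by simp [extAtZero, deriv_inv_weierstrassP_zero, h.s_zero, h.c_zero])

variable (hUc : IsPreconnected U)
include hUc

theorem eqOn_scExt : Set.EqOn (scExt L) (fun z => s z * c z) U :=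
  hL.isElliptic_and_hasSimplePolesExactlyAt_scExt.1.eqOn_of_eventuallyEq
    (fun _ hz => (h.analyticAt hU hz).1.mul (h.analyticAt hU hz).2) hUc h0
    ((hL.ext_eventuallyEq h hU h0).fun_comp Prod.fst)

theorem eqOn_sSqExt : Set.EqOn (sSqExt L) (fun z => s z ^ 2) U :=
  hL.isElliptic_and_hasSimplePolesExactlyAt_sSqExt.1.eqOn_of_eventuallyEq
    (fun _ hz => (h.analyticAt hU hz).1.fun_pow 2) hUc h0
    ((hL.ext_eventuallyEq h hU h0).fun_comp fun y => y.2.1)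

theorem eqOn_cSqExt : Set.EqOn (cSqExt L) (fun z => c z ^ 2) U :=
  hL.isElliptic_and_hasSimplePolesExactlyAt_cSqExt.1.eqOn_of_eventuallyEq
    (fun _ hz => (h.analyticAt hU hz).2.fun_pow 2) hUc h0
    ((hL.ext_eventuallyEq h hU h0).fun_comp fun y => y.2.2)

theorem notMem_polePoints_of_mem {z : ℂ} (hz : z ∈ U) : z ∉ polePoints := by
  have hana : AnalyticAt ℂ (fun z => s z * c z) z :=
    (h.analyticAt hU hz).1.mul (h.analyticAt hU hz).2
  refine hL.isElliptic_and_hasSimplePolesExactlyAt_scExt.2.notMem_of_analyticAt (hana.congr ?_)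
  exact (hL.eqOn_scExt h hU h0 hUc).symm.eventuallyEq_of_mem (hU.mem_nhds hz)

end IsLemniscatic

end Extensions

end Lemniscatic

theorem mainTheorem4 :
    (∃ L : PeriodPair, Lemniscatic.IsLemniscatic L) ∧
    ∀ L : PeriodPair, Lemniscatic.IsLemniscatic L →
      L.lattice = Submodule.span ℤ
        {2 * (Lemniscatic.omega : ℂ), 2 * Complex.I * (Lemniscatic.omega : ℂ)} ∧
      ∀ (U : Set ℂ) (s c : ℂ → ℂ), IsOpen U → IsPreconnected U → (0 : ℂ) ∈ U →
        Lemniscatic.IsIVPSolution U s c →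
        (∃ P : ℂ → ℂ,
          Lemniscatic.IsElliptic (2 * Lemniscatic.omega) (2 * Complex.I * Lemniscatic.omega) P ∧
          Set.EqOn P (fun z => s z * c z) U ∧
          Lemniscatic.HasSimplePolesExactlyAt P Lemniscatic.polePoints ∧
          (∀ z : ℂ, z ∉ L.lattice → L.weierstrassP z ^ 2 + 1 / 4 ≠ 0 →
            P z = -(1 / 2) * (L.derivWeierstrassP z / (L.weierstrassP z ^ 2 + 1 / 4)))) ∧
        (∃ C : ℂ → ℂ,
          Lemniscatic.IsElliptic (2 * Lemniscatic.omega) (2 * Complex.I * Lemniscatic.omega) C ∧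
          Set.EqOn C (fun z => c z ^ 2) U ∧
          Lemniscatic.HasSimplePolesExactlyAt C Lemniscatic.polePoints) ∧
        (∃ S : ℂ → ℂ,
          Lemniscatic.IsElliptic (2 * Lemniscatic.omega) (2 * Complex.I * Lemniscatic.omega) S ∧
          Set.EqOn S (fun z => s z ^ 2) U ∧
          Lemniscatic.HasSimplePolesExactlyAt S Lemniscatic.polePoints) ∧
        (∀ z ∈ U, z ∉ L.lattice → L.weierstrassP z ^ 2 + 1 / 4 ≠ 0 ∧
          s z * c z = -(1 / 2) * (L.derivWeierstrassP z / (L.weierstrassP z ^ 2 + 1 / 4))) := by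
  refine ⟨⟨_, Lemniscatic.isLemniscatic_squarePair_omega⟩, fun L hL => ⟨hL.lattice_eq, ?_⟩⟩
  intro U s c hU hUc h0 h
  obtain ⟨hsc, hsc_poles⟩ := hL.isElliptic_and_hasSimplePolesExactlyAt_scExt
  obtain ⟨hc, hc_poles⟩ := hL.isElliptic_and_hasSimplePolesExactlyAt_cSqExt
  obtain ⟨hs, hs_poles⟩ := hL.isElliptic_and_hasSimplePolesExactlyAt_sSqExt
  have hsc_eq := hL.eqOn_scExt h hU h0 hUc
  refine ⟨⟨Lemniscatic.scExt L, hsc, hsc_eq, hsc_poles, fun z _ _ => rfl⟩,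
    ⟨Lemniscatic.cSqExt L, hc, hL.eqOn_cSqExt h hU h0 hUc, hc_poles⟩,
    ⟨Lemniscatic.sSqExt L, hs, hL.eqOn_sSqExt h hU h0 hUc, hs_poles⟩,
    fun z hz hzL => ⟨?_, (hsc_eq hz).symm⟩⟩
  rw [Ne, hL.weierstrassP_sq_add_eq_zero_iff_mem_polePoints hzL]
  exact hL.notMem_polePoints_of_mem h hU h0 hUc hz
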